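/- All graphs are undirected and simple. A graph $G=(V,E)$, finite or infinite, is a \emph{permutation graph} if there are a linear order on $V$ and a permutation $\sigma$ of $V$ such that the edges of $G$ are exactly the pairs of vertices whose order is reversed by $\sigma$. A class of finite graphs (considered up to isomorphism) is \emph{hereditary} if it contains every finite graph that is isomorphic to an induced subgraph of one of its members. The \emph{age} of a graph $G$ is the hereditary class of all finite graphs that are isomorphic to an induced subgraph of $G$. A \emph{module} of $G=(V,E)$ is a set $A\subseteq V$ such that every vertex outside $A$ is adjacent to all or to none of the vertices of $A$; $G$ is \emph{prime} if its only modules are $\emptyset$, the singletons and $V$. A hereditary class $\mathcal C$ of finite graphs is \emph{minimal prime} if it contains infinitely many prime graphs (up to isomorphism), while every hereditary class $\mathcal D\subsetneq\mathcal C$ contains only finitely many. **Corollary.** There are exactly $2^{\aleph_0}$ ages of permutation graphs which are minimal prime. That is, the set of all minimal prime classes that are the age of some permutation graph has cardinality $2^{\aleph_0}$; likewise, the set of all minimal prime classes that are the age of some graph and all of whose members are permutation graphs has cardinality $2^{\aleph_0}$. -/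

import Mathlib

/-- A module of a graph `G`: a set `A` of vertices such that no vertex outside `A` distinguishes two
elements of `A`. -/
def IsGraphModule {V : Type*} (G : SimpleGraph V) (A : Set V) : Prop :=
  ∀ a ∈ A, ∀ a' ∈ A, ∀ x, x ∉ A → (G.Adj x a ↔ G.Adj x a')

/-- A graph is prime if its only modules are the trivial ones: the empty set, the singletons and
the whole vertex set. -/
def IsPrimeGraph {V : Type*} (G : SimpleGraph V) : Prop :=
  ∀ A : Set V, IsGraphModule G A → A = ∅ ∨ (∃ v, A = {v}) ∨ A = Set.univ

/-- A (finite or infinite) graph is a permutation graph if there are a linear order on its vertex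
set `V` and a permutation `σ` of `V` such that the edges are exactly the pairs of vertices that are
reversed by `σ`. -/
def IsPermutationGraph {V : Type*} (G : SimpleGraph V) : Prop :=
  ∃ (_ : LinearOrder V) (σ : Equiv.Perm V), ∀ x y : V,
    G.Adj x y ↔ (x < y ∧ σ y < σ x) ∨ (y < x ∧ σ x < σ y)

/-- Finite graphs, given by representatives on the vertex sets `Fin n`. Each isomorphism type has
at least one and only finitely many representatives. -/
abbrev FinGraph : Type := Σ n : ℕ, SimpleGraph (Fin n)

/-- A class of finite graphs is hereditary if it contains every finite graph which embeds (as an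
induced subgraph) into one of its members. In particular it is closed under isomorphism, so that
hereditary sets of representatives are the same as hereditary classes of isomorphism types. -/
def IsHereditary (C : Set FinGraph) : Prop :=
  ∀ G ∈ C, ∀ H : FinGraph, Nonempty (H.2 ↪g G.2) → H ∈ C

/-- The age of a graph `G`: the class of all finite graphs which embed into `G` (as induced
subgraphs). -/
def graphAge {V : Type*} (G : SimpleGraph V) : Set FinGraph :=
  {H | Nonempty (H.2 ↪g G)}

/-- The prime members of a class of finite graphs. -/
def primeMembers (C : Set FinGraph) : Set FinGraph :=
  {H | H ∈ C ∧ IsPrimeGraph H.2}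

/-- A minimal prime class: a hereditary class of finite graphs that contains infinitely many prime
graphs, while every proper hereditary subclass contains only finitely many. Since an isomorphism
type has finitely many representatives, it does not matter whether prime graphs are counted up to
isomorphism. -/
def IsMinimalPrimeClass (C : Set FinGraph) : Prop :=
  IsHereditary C ∧ (primeMembers C).Infinite ∧
    ∀ D : Set FinGraph, IsHereditary D → D ⊂ C → (primeMembers D).Finite

/-! Every class in question is a set of elements of the countable type `FinGraph`, which gives the
upper bound. For the lower bound, each `S ⊆ ℕ` containing 0 yields a graph `pinGraph (dyadicSet S)`.

Minimality: a missing vertex in the upper part of an induced subgraph of a pin graph makes the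
vertices below the gap a module. So a prime induced subgraph is an interval plus at most one stray
smaller vertex (`IsPrimeGraph.image_eq_insert_Ico`). If every initial pattern of `Z` recurs with
bounded gaps, each member of the age embeds in every sufficiently large prime member. A proper
hereditary subclass therefore has only small primes.

Permutation graph: the vertices are placed as a pin sequence in the plane, and adjacency is
inversion of the two coordinates.

Distinct ages: `dyadicSet S` is a clique, while a clique of `pinGraph Z` leaves `Z` at most twice.
An embedding of a long initial segment thus compares the number of elements of the two sets in
intervals of equal length, and these numbers differ at the least difference of `S` and `T`. -/

/-- The graph on `ℕ` in which a vertex `j` is adjacent, among the smaller vertices, to all but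
`j - 1` if `j ∈ Z`, and only to `j - 1` otherwise. -/
def pinGraph (Z : Set ℕ) : SimpleGraph ℕ where
  Adj i j := (i < j ∧ (j ∈ Z ↔ j ≠ i + 1)) ∨ (j < i ∧ (i ∈ Z ↔ i ≠ j + 1))
  symm := ⟨fun _ _ h => h.symm⟩
  loopless := ⟨fun _ h => by simp at h⟩

theorem pinGraph_adj_of_lt {Z : Set ℕ} {i j : ℕ} (h : i < j) :
    (pinGraph Z).Adj i j ↔ (j ∈ Z ↔ j ≠ i + 1) := by
  simp [pinGraph, h, not_lt_of_gt h]

theorem pinGraph_adj_of_gt {Z : Set ℕ} {i j : ℕ} (h : j < i) :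
    (pinGraph Z).Adj i j ↔ (i ∈ Z ↔ i ≠ j + 1) := by
  rw [SimpleGraph.adj_comm, pinGraph_adj_of_lt h]

/-- The range of a prime graph in `pinGraph Z` is an interval together with one smaller vertex. -/
theorem IsPrimeGraph.image_eq_insert_Ico {Z : Set ℕ} {n : ℕ} {H : SimpleGraph (Fin n)}
    (hH : IsPrimeGraph H) (hn : 2 ≤ n) (φ : H ↪g pinGraph Z) :
    ∃ a b, a < b ∧ Finset.univ.image φ = insert a (Finset.Ico b (b + (n - 1))) := by
  set A : Finset ℕ := Finset.univ.image φ with hA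
  have hcard : A.card = n := by
    rw [hA, Finset.card_image_of_injective _ φ.injective, Finset.card_univ, Fintype.card_fin]
  have hne : A.Nonempty := Finset.card_pos.1 (by omega)
  set a := A.min' hne with ha
  have haA : a ∈ A := A.min'_mem hne
  have hcard' : (A.erase a).card = n - 1 := by rw [Finset.card_erase_of_mem haA, hcard]
  have hne' : (A.erase a).Nonempty := Finset.card_pos.1 (by omega)
  set b := (A.erase a).min' hne' with hb
  have hbA : b ∈ A.erase a := (A.erase a).min'_mem hne'
  set c := (A.erase a).max' hne' with hc
  have hcA : c ∈ A.erase a := (A.erase a).max'_mem hne'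
  have hab : a < b := lt_of_le_of_ne (A.min'_le _ (Finset.mem_of_mem_erase hbA))
    (Finset.ne_of_mem_erase hbA).symm
  have hIcc : A.erase a = Finset.Icc b c := by
    ext i
    refine ⟨fun hi => Finset.mem_Icc.2 ⟨Finset.min'_le _ _ hi, Finset.le_max' _ _ hi⟩, fun hi => ?_⟩
    rw [Finset.mem_Icc] at hi
    by_contra hiA
    have hib : i ≠ b := fun h => hiA (h ▸ hbA)
    have hic : i ≠ c := fun h => hiA (h ▸ hcA)
    have hiA' : i ∉ A := fun h => hiA (Finset.mem_erase.2 ⟨by omega, h⟩)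
    obtain ⟨va, -, hva⟩ := Finset.mem_image.1 haA
    obtain ⟨vb, -, hvb⟩ := Finset.mem_image.1 (Finset.mem_of_mem_erase hbA)
    obtain ⟨vc, -, hvc⟩ := Finset.mem_image.1 (Finset.mem_of_mem_erase hcA)
    -- A vertex above the gap `i` is not the successor of any vertex below it, so it is joined to
    -- all or to none of those. The module contains the preimages of `a` and `b` but not that of
    -- `c`.
    have hmod : IsGraphModule H {v | φ v < i} := by
      intro p hp q hq x hx
      simp only [Set.mem_ofPred_eq, not_lt] at hp hq hx
      have hxi : φ x ≠ i := fun h => hiA' (h ▸ Finset.mem_image_of_mem _ (Finset.mem_univ _))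
      rw [← φ.map_adj_iff, ← φ.map_adj_iff (v := x) (w := q),
        pinGraph_adj_of_gt (by omega), pinGraph_adj_of_gt (by omega)]
      have h1 : φ x ≠ φ p + 1 := by omega
      have h2 : φ x ≠ φ q + 1 := by omega
      simp [h1, h2]
    have hma : va ∈ {v | φ v < i} := by simp only [Set.mem_ofPred_eq, hva]; omega
    have hmb : vb ∈ {v | φ v < i} := by simp only [Set.mem_ofPred_eq, hvb]; omega
    have hmc : vc ∉ {v | φ v < i} := by simp only [Set.mem_ofPred_eq, hvc]; omega
    rcases hH _ hmod with h | ⟨v, h⟩ | h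
    · simp [h] at hma
    · rw [h, Set.mem_singleton_iff] at hma hmb
      rw [hma, ← hmb, hvb] at hva
      omega
    · simp [h] at hmc
  refine ⟨a, b, hab, ?_⟩
  have hbc : b ≤ c := (A.erase a).min'_le _ hcA
  rw [hIcc, Nat.card_Icc] at hcard'
  rw [← Finset.insert_erase haA, hIcc]
  congr 1
  ext i
  simp only [Finset.mem_Icc, Finset.mem_Ico]
  omega

/-! ### Primality of initial segments -/

/-- The subgraph of `pinGraph Z` induced on `{0, …, n - 1}`. -/
def initialPinGraph (Z : Set ℕ) (n : ℕ) : SimpleGraph (Fin n) :=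
  (pinGraph Z).comap Fin.val

/-- The inclusion of an initial segment. -/
def initialPinGraphEmbedding (Z : Set ℕ) (n : ℕ) : initialPinGraph Z n ↪g pinGraph Z where
  toEmbedding := ⟨Fin.val, Fin.val_injective⟩
  map_rel_iff' := Iff.rfl

/-- With 1, …, 4 outside `Z`, the vertices 0, …, 4 induce a path, whose primality is a finite check.
This starts the induction for longer segments. -/
theorem isModule_Iic_four_trivial {Z : Set ℕ} (hZ : ∀ i, 1 ≤ i → i ≤ 4 → i ∉ Z) {M : Set ℕ}
    (hM : ∀ a ∈ M, ∀ b ∈ M, a ≤ 4 → b ≤ 4 → ∀ x, x ≤ 4 → x ∉ M →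
      ((pinGraph Z).Adj x a ↔ (pinGraph Z).Adj x b)) :
    (∀ a ∈ M, ∀ b ∈ M, a ≤ 4 → b ≤ 4 → a = b) ∨ ∀ a ≤ 4, a ∈ M := by
  have key : ∀ i j : ℕ, i ≤ 4 → j ≤ 4 → ((pinGraph Z).Adj i j ↔ (j = i + 1 ∨ i = j + 1)) := by
    intro i j hi hj
    rcases lt_trichotomy i j with h | rfl | h
    · rw [pinGraph_adj_of_lt h]
      have := hZ j (by omega) hj
      simp only [this, false_iff, not_not]
      omega
    · simp
    · rw [pinGraph_adj_of_gt h]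
      have := hZ i (by omega) hi
      simp only [this, false_iff, not_not]
      omega
  have fin : ∀ B : Finset (Fin 5),
      (∀ a ∈ B, ∀ b ∈ B, ∀ x, x ∉ B → ((a.val = x.val + 1 ∨ x.val = a.val + 1) ↔
        (b.val = x.val + 1 ∨ x.val = b.val + 1))) → (∀ a ∈ B, ∀ b ∈ B, a = b) ∨ ∀ a, a ∈ B := by
    decide
  classical
  have h := fin (Finset.univ.filter fun i : Fin 5 => i.val ∈ M) (by
    simp only [Finset.mem_filter, Finset.mem_univ, true_and]
    intro a ha b hb x hx
    rw [← key x a (by omega) (by omega), ← key x b (by omega) (by omega)]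
    exact hM a ha b hb (by omega) (by omega) x (by omega) hx)
  simp only [Finset.mem_filter, Finset.mem_univ, true_and] at h
  refine h.imp (fun h a ha b hb h1 h2 => ?_) (fun h a ha => h ⟨a, by omega⟩)
  exact congrArg Fin.val (h ⟨a, by omega⟩ ha ⟨b, by omega⟩ hb)

/-- The trace of a module on a shorter segment is again a module, hence trivial by induction. What
remains is to exclude that the new vertex is a twin of an old one, or that it is the only vertex
left out. -/
theorem isModule_Iic_trivial {Z : Set ℕ} (hZ : ∀ i, 1 ≤ i → i ≤ 4 → i ∉ Z) {M : Set ℕ} {n : ℕ}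
    (hn : 4 ≤ n) (hM : ∀ a ∈ M, ∀ b ∈ M, a ≤ n → b ≤ n → ∀ x, x ≤ n → x ∉ M →
      ((pinGraph Z).Adj x a ↔ (pinGraph Z).Adj x b)) :
    (∀ a ∈ M, ∀ b ∈ M, a ≤ n → b ≤ n → a = b) ∨ ∀ a ≤ n, a ∈ M := by
  induction n, hn using Nat.le_induction with
  | base => exact isModule_Iic_four_trivial hZ hM
  | succ n hn ih =>
    have hlast : ∀ i < n, ((pinGraph Z).Adj (n + 1) i ↔ n + 1 ∈ Z) := fun i hi => by
      rw [pinGraph_adj_of_gt (by omega)]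
      simp [show n ≠ i by omega]
    have hlast' : (pinGraph Z).Adj (n + 1) n ↔ n + 1 ∉ Z := by
      rw [pinGraph_adj_of_gt (by omega)]; simp
    by_cases hmem : n + 1 ∈ M
    · rcases ih fun a ha b hb h1 h2 x hx hxM =>
        hM a ha b hb (by omega) (by omega) x (by omega) hxM with h | h
      · by_cases hk : ∃ k ∈ M, k ≤ n
        · exfalso
          obtain ⟨k, hkM, hkn⟩ := hk
          -- As a twin of `n + 1`, the vertex `k` must treat all `x < n` alike; `x = n` is left out
          -- because it is the exception for `n + 1`.
          have htwin : ∀ x < n, x ≠ k → ((pinGraph Z).Adj x k ↔ n + 1 ∈ Z) := by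
            intro x hx hxk
            rw [hM k hkM (n + 1) hmem (by omega) le_rfl x (by omega)
              (fun hxM => hxk (h x hxM k hkM (by omega) hkn)), SimpleGraph.adj_comm]
            exact hlast x hx
          obtain hk4 | hk4 := le_or_gt k 3
          · have hadj : ∀ x ≤ 3, x ≠ k → ((x = k + 1 ∨ k = x + 1) ↔ n + 1 ∈ Z) := by
              intro x hx hxk
              rw [← htwin x (by omega) hxk]
              rcases lt_or_gt_of_ne hxk with hlt | hlt
              · have := hZ k (by omega) (by omega)
                rw [pinGraph_adj_of_lt hlt]
                simp only [this, false_iff, not_not]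
                omega
              · have := hZ x (by omega) (by omega)
                rw [pinGraph_adj_of_gt hlt]
                simp only [this, false_iff, not_not]
                omega
            obtain ⟨x, hx, hxk, hxa⟩ : ∃ x ≤ 3, x ≠ k ∧ (x = k + 1 ∨ k = x + 1) := by
              rcases Nat.eq_zero_or_pos k with rfl | h
              · exact ⟨1, by omega⟩
              · exact ⟨k - 1, by omega⟩
            obtain ⟨y, hy, hyk, hya⟩ : ∃ y ≤ 3, y ≠ k ∧ ¬(y = k + 1 ∨ k = y + 1) := by
              rcases Nat.lt_or_ge 1 k with h | h
              · exact ⟨0, by omega⟩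
              · exact ⟨k + 2, by omega⟩
            exact hya ((hadj y hy hyk).2 ((hadj x hx hxk).1 hxa))
          -- For `k ≥ 4`, the vertex `k` distinguishes `k - 1` from 0.
          · have h0 := htwin 0 (by omega) (by omega)
            have h1 := htwin (k - 1) (by omega) (by omega)
            rw [pinGraph_adj_of_lt (by omega)] at h0 h1
            have e0 : k ≠ 0 + 1 := by omega
            have e1 : k = k - 1 + 1 := by omega
            by_cases hkZ : k ∈ Z <;> by_cases hnZ : n + 1 ∈ Z
            · exact (h1.2 hnZ).1 hkZ e1
            · exact hnZ (h0.1 ⟨fun _ => e0, fun _ => hkZ⟩)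
            · exact hkZ ((h0.2 hnZ).2 e0)
            · exact hnZ (h1.1 ⟨fun h => absurd h hkZ, fun h => absurd e1 h⟩)
        · left
          push Not at hk
          intro a ha b hb _ _
          have := hk a ha
          have := hk b hb
          omega
      · right
        intro a ha
        rcases Nat.lt_or_ge n a with h' | h'
        · rwa [show a = n + 1 by omega]
        · exact h a h'
    · have hle : ∀ a ∈ M, a ≤ n + 1 → a ≤ n := fun a ha h1 => by
        by_contra h
        exact hmem (show a = n + 1 by omega ▸ ha)
      rcases ih fun a ha b hb h1 h2 x hx hxM =>
        hM a ha b hb (by omega) (by omega) x (by omega) hxM with h | h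
      · exact Or.inl fun a ha b hb h1 h2 => h a ha b hb (hle a ha h1) (hle b hb h2)
      · exfalso
        -- The vertex `n + 1` distinguishes `n` from 0.
        have := hM n (h n le_rfl) 0 (h 0 (by omega)) (by omega) (by omega) (n + 1) le_rfl hmem
        rw [hlast', hlast 0 (by omega)] at this
        tauto

theorem isPrimeGraph_initialPinGraph {Z : Set ℕ} (hZ : ∀ i, 1 ≤ i → i ≤ 4 → i ∉ Z) {n : ℕ}
    (hn : 5 ≤ n) : IsPrimeGraph (initialPinGraph Z n) := by
  intro A hA
  have hA' : ∀ i (hi : i < n), (i ∈ Fin.val '' A ↔ ⟨i, hi⟩ ∈ A) := fun i hi =>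
    ⟨fun ⟨v, hv, h⟩ => by subst h; exact hv, fun h => ⟨_, h, rfl⟩⟩
  rcases isModule_Iic_trivial (M := Fin.val '' A) (n := n - 1) hZ (by omega) (by
    rintro _ ⟨a, ha, rfl⟩ _ ⟨b, hb, rfl⟩ _ _ x hx hxA
    exact hA a ha b hb ⟨x, by omega⟩ fun h => hxA ⟨_, h, rfl⟩) with h | h
  · rcases A.eq_empty_or_nonempty with h0 | ⟨v, hv⟩
    · exact Or.inl h0
    · refine Or.inr (Or.inl ⟨v, Set.eq_singleton_iff_unique_mem.2 ⟨hv, fun w hw => Fin.ext ?_⟩⟩)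
      exact h w ⟨w, hw, rfl⟩ v ⟨v, hv, rfl⟩ (by omega) (by omega)
  · exact Or.inr (Or.inr (Set.eq_univ_of_forall fun v =>
      (hA' v v.2).1 (h v (by omega))))

/-! ### Ages, recurrence and minimality -/

theorem isHereditary_graphAge {V : Type*} (G : SimpleGraph V) : IsHereditary (graphAge G) :=
  fun _ ⟨f⟩ _ ⟨g⟩ => ⟨f.comp g⟩

/-- An embedding factors through another one with larger range. -/
theorem nonempty_embedding_of_range_subset {U V W : Type*} {F : SimpleGraph U} {H : SimpleGraph V}
    {G : SimpleGraph W} (ψ : F ↪g G) (φ : H ↪g G) (h : Set.range ψ ⊆ Set.range φ) :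
    Nonempty (F ↪g H) := by
  choose g hg using fun u => h (Set.mem_range_self u)
  refine ⟨⟨⟨g, fun u v huv => ψ.injective ?_⟩, ?_⟩⟩
  · rw [← hg, ← hg, huv]
  · intro u v
    change H.Adj (g u) (g v) ↔ F.Adj u v
    rw [← φ.map_adj_iff, hg, hg, ψ.map_adj_iff]

theorem finite_setOf_fst_le (N : ℕ) : {H : FinGraph | H.1 ≤ N}.Finite := by
  have : {H : FinGraph | H.1 ≤ N} ⊆
      Set.range fun p : (Σ n : Fin (N + 1), SimpleGraph (Fin n)) => (⟨p.1, p.2⟩ : FinGraph) := by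
    rintro ⟨n, H⟩ h
    exact ⟨⟨⟨n, Nat.lt_succ_of_le h⟩, H⟩, rfl⟩
  exact (Set.finite_range _).subset this

/-- If every initial part of `Z` recurs with bounded gaps, the age of `pinGraph Z` is minimal
prime. -/
theorem isMinimalPrimeClass_graphAge_pinGraph {Z : Set ℕ} (hZ : ∀ i, 1 ≤ i → i ≤ 4 → i ∉ Z)
    (hrec : ∀ m, ∃ N, ∀ b, ∃ t, b ≤ t ∧ t + m ≤ b + N ∧
      ∀ j, 0 < j → j < m → (t + j ∈ Z ↔ j ∈ Z)) :
    IsMinimalPrimeClass (graphAge (pinGraph Z)) := by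
  refine ⟨isHereditary_graphAge _, ?_, fun D hD hDC => ?_⟩
  · refine Set.infinite_of_injective_forall_mem
      (f := fun n : ℕ => (⟨n + 5, initialPinGraph Z (n + 5)⟩ : FinGraph)) ?_ ?_
    · intro n m h
      have := congrArg Sigma.fst h
      simpa using this
    · exact fun n => ⟨⟨initialPinGraphEmbedding Z _⟩, isPrimeGraph_initialPinGraph hZ (by simp)⟩
  · obtain ⟨F, ⟨ψ⟩, hFD⟩ := Set.exists_of_ssubset hDC
    obtain ⟨m, hm⟩ : ∃ m, ∀ v, ψ v < m := by
      obtain ⟨m, hm⟩ := (Set.finite_range ψ).bddAbove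
      exact ⟨m + 1, fun v => Nat.lt_succ_of_le (hm ⟨v, rfl⟩)⟩
    obtain ⟨N, hN⟩ := hrec m
    refine (finite_setOf_fst_le (N + 1)).subset fun H hH => ?_
    by_contra hlt
    simp only [Set.mem_ofPred_eq, not_le] at hlt
    obtain ⟨φ⟩ := hDC.1 hH.1
    obtain ⟨a, b, -, himg⟩ := hH.2.image_eq_insert_Ico (by omega) φ
    obtain ⟨t, hbt, htN, ht⟩ := hN b
    -- Only the larger endpoint's membership in `Z` decides adjacency, so the pattern need not agree
    -- at offset 0.
    have hshift : ∀ i j, i < m → j < m →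
        ((pinGraph Z).Adj (t + i) (t + j) ↔ (pinGraph Z).Adj i j) := by
      intro i j hi hj
      rcases lt_trichotomy i j with h | rfl | h
      · rw [pinGraph_adj_of_lt h, pinGraph_adj_of_lt (by omega), ht j (by omega) hj,
          show t + j ≠ t + i + 1 ↔ j ≠ i + 1 by omega]
      · simp
      · rw [pinGraph_adj_of_gt h, pinGraph_adj_of_gt (by omega), ht i (by omega) hi,
          show t + i ≠ t + j + 1 ↔ i ≠ j + 1 by omega]
    let ψ' : F.2 ↪g pinGraph Z :=
      ⟨⟨fun v => t + ψ v, fun u v h => ψ.injective (Nat.add_left_cancel h)⟩, fun {u v} =>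
        (hshift _ _ (hm u) (hm v)).trans ψ.map_adj_iff⟩
    refine hFD (hD H hH.1 F (nonempty_embedding_of_range_subset ψ' φ ?_))
    rintro _ ⟨v, rfl⟩
    have hmem : t + ψ v ∈ Finset.univ.image φ := by
      rw [himg, Finset.mem_insert, Finset.mem_Ico]
      have := hm v
      omega
    obtain ⟨w, -, hw⟩ := Finset.mem_image.1 hmem
    exact ⟨w, hw⟩

/-! ### Cliques of pin graphs -/

/-- A clique of `pinGraph Z` has at most two vertices outside `Z`. -/
theorem card_clique_sdiff_le {Z : Set ℕ} [DecidablePred (· ∈ Z)] {K : Finset ℕ}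
    (hK : (pinGraph Z).IsClique K) : (K.filter (· ∉ Z)).card ≤ 2 := by
  by_contra! h
  obtain ⟨p, q, r, hp, hq, hr, hpq, hqr⟩ : ∃ p q r, p ∈ K ∧ q ∈ K ∧ (r ∈ K ∧ r ∉ Z) ∧
      p < q ∧ q < r := by
    let e := (K.filter (· ∉ Z)).orderEmbOfFin rfl
    have he : ∀ i, e i ∈ K ∧ e i ∉ Z := fun i =>
      Finset.mem_filter.1 (Finset.orderEmbOfFin_mem _ rfl i)
    exact ⟨e ⟨0, by omega⟩, e ⟨1, by omega⟩, e ⟨2, by omega⟩, (he _).1, (he _).1, he _,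
      e.strictMono (by simp [Fin.lt_def]), e.strictMono (by simp [Fin.lt_def])⟩
  -- Outside `Z`, the vertex `r` has only `r - 1` as a smaller neighbour, which leaves no room for
  -- `q`.
  have h1 := (pinGraph_adj_of_lt (hpq.trans hqr)).1 (hK hp hr.1 (by omega))
  simp only [hr.2, false_iff, not_not] at h1
  omega

/-! ### Pin graphs as permutation graphs -/

/-- Two injections into a linear order whose ranges are order isomorphic realize their inversion
graph as a permutation graph. -/
theorem isPermutationGraph_of_inversions {V α : Type*} [LinearOrder α] {G : SimpleGraph V}
    {f g : V → α} (hf : Function.Injective f) (hg : Function.Injective g)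
    (e : Set.range g ≃o Set.range f)
    (h : ∀ x y, G.Adj x y ↔ (f x < f y ∧ g y < g x) ∨ (f y < f x ∧ g x < g y)) :
    IsPermutationGraph G := by
  let σ : Equiv.Perm V :=
    (Equiv.ofInjective g hg).trans (e.toEquiv.trans (Equiv.ofInjective f hf).symm)
  have hσ : ∀ v, f (σ v) = e ⟨g v, v, rfl⟩ := fun v =>
    Equiv.apply_ofInjective_symm hf _
  have hσ' : ∀ x y, f (σ x) < f (σ y) ↔ g x < g y := fun x y => by
    rw [hσ, hσ, Subtype.coe_lt_coe, e.lt_iff_lt]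
    rfl
  refine ⟨LinearOrder.lift' f hf, σ, fun x y => ?_⟩
  rw [h, ← hσ', ← hσ']
  rfl

/-- Finite induced subgraphs of permutation graphs are permutation graphs. -/
theorem IsPermutationGraph.of_embedding {V : Type*} {G : SimpleGraph V} (hG : IsPermutationGraph G)
    {n : ℕ} {H : SimpleGraph (Fin n)} (φ : H ↪g G) : IsPermutationGraph H := by
  classical
  obtain ⟨_, σ, h⟩ := hG
  have hσ : Function.Injective (σ ∘ φ) := σ.injective.comp φ.injective
  have hc : ∀ {f : Fin n → V}, Function.Injective f → Fintype.card (Set.range f) = n :=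
    fun hf => (Set.card_range_of_injective hf).trans (Fintype.card_fin n)
  refine isPermutationGraph_of_inversions φ.injective hσ
    ((monoEquivOfFin _ (hc hσ)).symm.trans (monoEquivOfFin _ (hc φ.injective))) fun x y => ?_
  rw [← φ.map_adj_iff, h]
  rfl

/-- A set of integers that is unbounded in both directions is order isomorphic to `ℤ`. -/
theorem nonempty_orderIso_int_of_unbounded {A : Set ℤ} (h1 : ∀ B, ∃ a ∈ A, B < a)
    (h2 : ∀ B, ∃ a ∈ A, a < B) : Nonempty (A ≃o ℤ) := by
  classical
  have : Nonempty A := let ⟨a, ha, _⟩ := h1 0; ⟨⟨a, ha⟩⟩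
  have : NoMaxOrder A := ⟨fun b => let ⟨a, ha, hb⟩ := h1 b; ⟨⟨a, ha⟩, hb⟩⟩
  have : NoMinOrder A := ⟨fun b => let ⟨a, ha, hb⟩ := h2 b; ⟨⟨a, ha⟩, hb⟩⟩
  let : SuccOrder A := LinearLocallyFiniteOrder.succOrder A
  let : PredOrder A := LinearLocallyFiniteOrder.predOrder A
  exact ⟨orderIsoIntOfLinearSuccPredArch⟩

/-- A sign that changes at each positive element of `Z`. -/
noncomputable def pinSign (Z : Set ℕ) : ℕ → ℤ
  | 0 => 1
  | n + 1 => open Classical in if n + 1 ∈ Z then -pinSign Z n else pinSign Z n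

/-- The coordinate of a pin in the direction in which it is extreme. -/
noncomputable def pinFar (Z : Set ℕ) (n : ℕ) : ℤ := pinSign Z n * (2 * n)

/-- The coordinate of a pin in the direction in which it separates its predecessor from the earlier
pins. -/
noncomputable def pinNear (Z : Set ℕ) : ℕ → ℤ
  | 0 => 0
  | n + 1 => pinSign Z n * (2 * n - 1)

/-- One of the two coordinates of a pin: odd pins are extreme for `p = false`, even pins for
`p = true`. -/
noncomputable def pinCoord (Z : Set ℕ) (p : Bool) (n : ℕ) : ℤ :=
  if n.bodd = p then pinNear Z n else pinFar Z n

theorem pinSign_succ_of_mem {Z : Set ℕ} {n : ℕ} (h : n + 1 ∈ Z) :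
    pinSign Z (n + 1) = -pinSign Z n := by
  rw [pinSign, if_pos h]

theorem pinSign_succ_of_notMem {Z : Set ℕ} {n : ℕ} (h : n + 1 ∉ Z) :
    pinSign Z (n + 1) = pinSign Z n := by
  rw [pinSign, if_neg h]

theorem pinSign_eq (Z : Set ℕ) (n : ℕ) : pinSign Z n = 1 ∨ pinSign Z n = -1 := by
  induction n with
  | zero => exact Or.inl rfl
  | succ n ih =>
    by_cases h : n + 1 ∈ Z
    · rw [pinSign_succ_of_mem h]; omega
    · rwa [pinSign_succ_of_notMem h]

theorem abs_pinCoord_le (Z : Set ℕ) (p : Bool) (n : ℕ) :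
    -(2 * n : ℤ) ≤ pinCoord Z p n ∧ pinCoord Z p n ≤ 2 * n := by
  unfold pinCoord
  split_ifs
  · cases n with
    | zero => simp [pinNear]
    | succ n =>
      rw [pinNear]
      rcases pinSign_eq Z n with h | h <;> rw [h] <;> push_cast <;> omega
  · rw [pinFar]
    rcases pinSign_eq Z n with h | h <;> rw [h] <;> omega

/-- The position of an extreme coordinate relative to the earlier pins. -/
theorem pinCoord_lt_pinFar_iff {Z : Set ℕ} {p : Bool} {i j : ℕ} (h : i < j) :
    (pinCoord Z p i < pinFar Z j ↔ pinSign Z j = 1) ∧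
      (pinFar Z j < pinCoord Z p i ↔ pinSign Z j = -1) := by
  have := abs_pinCoord_le Z p i
  rw [pinFar]
  rcases pinSign_eq Z j with h | h <;> rw [h] <;> omega

/-- The position of a separating coordinate relative to the earlier pins. -/
theorem pinCoord_lt_pinNear_iff {Z : Set ℕ} {p : Bool} {i j : ℕ} (h : i ≤ j)
    (hp : (j + 1).bodd = p) :
    (pinCoord Z p i < pinNear Z (j + 1) ↔ (pinSign Z j = 1 ↔ i ≠ j)) ∧
      (pinNear Z (j + 1) < pinCoord Z p i ↔ (pinSign Z j = -1 ↔ i ≠ j)) := by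
  rw [pinNear]
  rcases h.eq_or_lt with rfl | h
  · have : i.bodd ≠ p := by
      subst hp; simp
    rw [pinCoord, if_neg this, pinFar]
    rcases pinSign_eq Z i with h | h <;> rw [h] <;> simp
  · have := abs_pinCoord_le Z p i
    rcases pinSign_eq Z j with h | h <;> rw [h] <;> omega

theorem pinCoord_injective (Z : Set ℕ) (p : Bool) : Function.Injective (pinCoord Z p) := by
  intro i j heq
  by_contra hne
  wlog hij : i < j generalizing i j
  · exact this heq.symm (Ne.symm hne) (by omega)
  by_cases hp : j.bodd = p
  · rw [pinCoord.eq_def Z p j, if_pos hp] at heq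
    obtain ⟨j, rfl⟩ := Nat.exists_eq_succ_of_ne_zero (Nat.ne_zero_of_lt hij)
    have := pinCoord_lt_pinNear_iff (Z := Z) (p := p) (Nat.le_of_lt_succ hij) hp
    rw [heq] at this
    have := pinSign_eq Z j
    simp only [Nat.succ_eq_add_one, lt_self_iff_false, false_iff] at *
    omega
  · rw [pinCoord.eq_def Z p j, if_neg hp] at heq
    have := pinCoord_lt_pinFar_iff (Z := Z) (p := p) hij
    rw [heq] at this
    have := pinSign_eq Z j
    simp only [lt_self_iff_false, false_iff] at *
    omega

/-- Pin `j + 1` lies beyond all earlier pins in one coordinate, on the side given by its own sign.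
In the other it lies on the side given by the sign of `j`, just short of pin `j`. Equal signs invert
it with `j` alone, opposite signs with all earlier pins but `j`. -/
theorem pinGraph_adj_iff_inversion (Z : Set ℕ) (x y : ℕ) :
    (pinGraph Z).Adj x y ↔
      (pinCoord Z false x < pinCoord Z false y ∧ pinCoord Z true y < pinCoord Z true x) ∨
        (pinCoord Z false y < pinCoord Z false x ∧ pinCoord Z true x < pinCoord Z true y) := by
  wlog h : x < y generalizing x y
  · rcases (not_lt.1 h).eq_or_lt with rfl | h
    · simp
    · rw [SimpleGraph.adj_comm, this y x h, or_comm]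
  rw [pinGraph_adj_of_lt h]
  obtain ⟨j, rfl⟩ := Nat.exists_eq_succ_of_ne_zero (Nat.ne_zero_of_lt h)
  have key : ∀ p : Bool, (j + 1).bodd = p →
      ((j + 1 ∈ Z ↔ j + 1 ≠ x + 1) ↔
        (pinCoord Z (!p) x < pinCoord Z (!p) (j + 1) ∧ pinCoord Z p (j + 1) < pinCoord Z p x) ∨
        (pinCoord Z (!p) (j + 1) < pinCoord Z (!p) x ∧
          pinCoord Z p x < pinCoord Z p (j + 1))) := by
    intro p hp
    have hp' : (j + 1).bodd ≠ !p := by subst hp; simp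
    rw [pinCoord.eq_def Z p (j + 1), if_pos hp, pinCoord.eq_def Z (!p) (j + 1), if_neg hp',
      (pinCoord_lt_pinFar_iff h).1, (pinCoord_lt_pinFar_iff h).2,
      (pinCoord_lt_pinNear_iff (Nat.le_of_lt_succ h) hp).1,
      (pinCoord_lt_pinNear_iff (Nat.le_of_lt_succ h) hp).2]
    by_cases hj : j + 1 ∈ Z
    · rw [pinSign_succ_of_mem hj]
      rcases pinSign_eq Z j with h | h <;> rw [h] <;> simp [hj] <;> omega
    · rw [pinSign_succ_of_notMem hj]
      rcases pinSign_eq Z j with h | h <;> rw [h] <;> simp [hj] <;> omega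
  cases hb : (j + 1).bodd
  · rw [key _ hb, Nat.succ_eq_add_one, Bool.not_false]
    tauto
  · rw [key _ hb, Nat.succ_eq_add_one, Bool.not_true]

/-- If the sign changes infinitely often, always at isolated even positions, each coordinate is
unbounded in both directions. -/
theorem exists_pinCoord_eq {Z : Set ℕ}
    (hZ : ∀ B, ∃ z ∈ Z, B < z ∧ z.bodd = false ∧ z + 1 ∉ Z ∧ z - 1 ∉ Z) (p : Bool) (s : ℤ)
    (hs : s = 1 ∨ s = -1) (B : ℕ) : ∃ n, B < n ∧ pinCoord Z p n = s * (2 * n) := by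
  suffices h : ∃ n, B < n ∧ n.bodd ≠ p ∧ pinSign Z n = s by
    obtain ⟨n, hn, hp, hs⟩ := h
    exact ⟨n, hn, by rw [pinCoord, if_neg hp, pinFar, hs]⟩
  obtain ⟨z, hzZ, hz, hzb, h1, h2⟩ := hZ (B + 2)
  -- The sign is constant on `w, w + 1` and opposite on `w + 2, w + 3`, so each parity meets both
  -- signs.
  obtain ⟨w, rfl⟩ : ∃ w, z = w + 2 := ⟨z - 2, by omega⟩
  have e1 : pinSign Z (w + 1) = pinSign Z w := pinSign_succ_of_notMem h2
  have e2 : pinSign Z (w + 2) = -pinSign Z (w + 1) := pinSign_succ_of_mem hzZ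
  have e3 : pinSign Z (w + 3) = pinSign Z (w + 2) := pinSign_succ_of_notMem h1
  have hw : w.bodd = false := by simpa using hzb
  have hsign := pinSign_eq Z w
  by_cases hsw : pinSign Z w = s <;> cases p
  · exact ⟨w + 1, by omega, by simp [hw], by omega⟩
  · exact ⟨w, by omega, by simp [hw], hsw⟩
  · exact ⟨w + 3, by omega, by simp [hw], by omega⟩
  · exact ⟨w + 2, by omega, by simp [hw], by omega⟩

theorem isPermutationGraph_pinGraph {Z : Set ℕ}
    (hZ : ∀ B, ∃ z ∈ Z, B < z ∧ z.bodd = false ∧ z + 1 ∉ Z ∧ z - 1 ∉ Z) :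
    IsPermutationGraph (pinGraph Z) := by
  have key : ∀ p, Nonempty (Set.range (pinCoord Z p) ≃o ℤ) := fun p => by
    refine nonempty_orderIso_int_of_unbounded (fun B => ?_) (fun B => ?_)
    · obtain ⟨n, hn, h⟩ := exists_pinCoord_eq hZ p 1 (Or.inl rfl) B.natAbs
      exact ⟨_, ⟨n, rfl⟩, by omega⟩
    · obtain ⟨n, hn, h⟩ := exists_pinCoord_eq hZ p (-1) (Or.inr rfl) B.natAbs
      exact ⟨_, ⟨n, rfl⟩, by omega⟩
  obtain ⟨e⟩ := key false
  obtain ⟨e'⟩ := key true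
  exact isPermutationGraph_of_inversions (pinCoord_injective Z false) (pinCoord_injective Z true)
    (e'.trans e.symm) (pinGraph_adj_iff_inversion Z)

/-! ### Dyadic sets and their recurrence -/

/-- The numbers congruent to `4 ^ (i + 2)` modulo `2 * 4 ^ (i + 2)` for some `i ∈ S`. -/
def dyadicSet (S : Set ℕ) : Set ℕ := {n | ∃ i ∈ S, n % (2 * 4 ^ (i + 2)) = 4 ^ (i + 2)}

theorem two_mul_four_pow_dvd {i j : ℕ} (h : i < j) : 2 * 4 ^ i ∣ 4 ^ j := by
  exact dvd_trans ⟨2, by ring⟩ (pow_dvd_pow 4 (show i + 1 ≤ j from h))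

theorem pow_dvd_of_mod_eq {n i : ℕ} (h : n % (2 * 4 ^ i) = 4 ^ i) : 4 ^ i ∣ n := by
  rw [← Nat.mod_add_div n (2 * 4 ^ i), h]
  exact dvd_add dvd_rfl ((Dvd.intro_left 2 rfl).mul_right _)

theorem not_dvd_of_mod_eq {n i d : ℕ} (h : n % (2 * 4 ^ i) = 4 ^ i) (hd : 2 * 4 ^ i ∣ d) :
    ¬d ∣ n := fun hn => by
  rw [Nat.mod_eq_zero_of_dvd (hd.trans hn)] at h
  exact pow_ne_zero i (by norm_num) h.symm

theorem sixteen_dvd_of_mem_dyadicSet {S : Set ℕ} {n : ℕ} (h : n ∈ dyadicSet S) : 16 ∣ n := by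
  obtain ⟨i, -, hi⟩ := h
  exact dvd_trans ⟨4 ^ i, by ring⟩ (pow_dvd_of_mod_eq hi)

theorem add_mod_two_mul_four_pow {n i d : ℕ} (hd : 2 * 4 ^ i ∣ d) :
    (n + d) % (2 * 4 ^ i) = n % (2 * 4 ^ i) := by
  rw [Nat.add_mod, Nat.mod_eq_zero_of_dvd hd, add_zero, Nat.mod_mod]

/-- Membership depends only on the 2-adic valuation, which for `0 < n < 4 ^ (K + 2)` is unchanged by
adding a multiple of `4 ^ (K + 2)`. -/
theorem add_mem_dyadicSet_iff {S : Set ℕ} {K n t : ℕ} (h0 : 0 < n) (hn : n < 4 ^ (K + 2))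
    (ht : 4 ^ (K + 2) ∣ t) : t + n ∈ dyadicSet S ↔ n ∈ dyadicSet S := by
  refine exists_congr fun i => and_congr_right fun _ => ?_
  rw [add_comm]
  rcases Nat.lt_or_ge i K with hi | hi
  · rw [add_mod_two_mul_four_pow ((two_mul_four_pow_dvd (by omega)).trans ht)]
  · have hd : 4 ^ (K + 2) ∣ 4 ^ (i + 2) := pow_dvd_pow 4 (by omega)
    refine iff_of_false (fun h => ?_) (fun h => ?_)
    · exact Nat.not_dvd_of_pos_of_lt h0 hn
        ((Nat.dvd_add_left ht).1 (hd.trans (pow_dvd_of_mod_eq h)))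
    · exact Nat.not_dvd_of_pos_of_lt h0 hn (hd.trans (pow_dvd_of_mod_eq h))

theorem dyadicSet_recurrent (S : Set ℕ) (m : ℕ) : ∃ N, ∀ b, ∃ t, b ≤ t ∧ t + m ≤ b + N ∧
    ∀ j, 0 < j → j < m → (t + j ∈ dyadicSet S ↔ j ∈ dyadicSet S) := by
  have hm : m < 4 ^ (m + 2) := (Nat.lt_pow_self (by norm_num)).trans
    (Nat.pow_lt_pow_right (by norm_num) (by omega))
  refine ⟨4 ^ (m + 2) + m, fun b => ⟨4 ^ (m + 2) * (b / 4 ^ (m + 2) + 1), ?_, ?_,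
    fun j h0 hj => add_mem_dyadicSet_iff h0 (hj.trans hm) (Dvd.intro _ rfl)⟩⟩
  · exact (Nat.lt_mul_div_succ b (by positivity)).le
  · have := Nat.mul_div_le b (4 ^ (m + 2))
    rw [mul_add]
    omega

theorem dyadicSet_isolated_even {S : Set ℕ} (hS : 0 ∈ S) (B : ℕ) :
    ∃ z ∈ dyadicSet S, B < z ∧ z.bodd = false ∧ z + 1 ∉ dyadicSet S ∧ z - 1 ∉ dyadicSet S := by
  refine ⟨32 * B + 16, ⟨0, hS, by norm_num⟩, by omega, by simp,
    fun h => ?_, fun h => ?_⟩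
  all_goals
    have := sixteen_dvd_of_mem_dyadicSet h
    omega

theorem isMinimalPrimeClass_graphAge_dyadicSet (S : Set ℕ) :
    IsMinimalPrimeClass (graphAge (pinGraph (dyadicSet S))) := by
  refine isMinimalPrimeClass_graphAge_pinGraph (fun i h1 h4 h => ?_) (dyadicSet_recurrent S)
  have := sixteen_dvd_of_mem_dyadicSet h
  omega

theorem isClique_dyadicSet (S : Set ℕ) : (pinGraph (dyadicSet S)).IsClique (dyadicSet S) := by
  intro i hi j hj hij
  have h1 := sixteen_dvd_of_mem_dyadicSet hi
  have h2 := sixteen_dvd_of_mem_dyadicSet hj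
  rcases lt_or_gt_of_ne hij with h | h
  · exact (pinGraph_adj_of_lt h).2 (iff_of_true hj (by omega))
  · exact (pinGraph_adj_of_gt h).2 (iff_of_true hi (by omega))

/-! ### Distinguishing the ages -/

/-- If `k` is the least difference of `S` and `T` and `k ∈ S`, then long intervals contain more
elements of `dyadicSet S` than of `dyadicSet T`. -/
theorem card_dyadicSet_lt {S T : Set ℕ} {k : ℕ} (hlt : ∀ i < k, (i ∈ S ↔ i ∈ T)) (hS : k ∈ S)
    (hT : k ∉ T) [DecidablePred (· ∈ dyadicSet S)] [DecidablePred (· ∈ dyadicSet T)] :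
    ∃ M, 5 ≤ M ∧ ∀ b, ((Finset.Ico b (b + M)).filter (· ∈ dyadicSet T)).card + 4 ≤
      ((Finset.range M).filter (· ∈ dyadicSet S)).card := by
  classical
  set e := 4 ^ (k + 2) with he
  have hpos : 0 < e := by positivity
  let common : ℕ → Prop := fun n => ∃ i < k, i ∈ S ∧ n % (2 * 4 ^ (i + 2)) = 4 ^ (i + 2)
  -- In a window of length `16 * e`, level `k` contributes 8 elements to `dyadicSet S`. All higher
  -- levels of `T` lie among the multiples of `4 * e`, at most 4 of them. Powers of 4 rather than 2
  -- create this gap.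
  refine ⟨16 * e, by omega, fun b => ?_⟩
  have hper : Function.Periodic common (16 * e) := fun n => by
    refine propext (exists_congr fun i => and_congr_right fun hi => ?_)
    rw [add_mod_two_mul_four_pow ((two_mul_four_pow_dvd (show i + 2 < k + 2 by omega)).trans
      (Dvd.intro_left _ rfl))]
  have hper' : Function.Periodic (fun n => n ≡ 0 [MOD 4 * e]) (16 * e) := fun n => by
    refine propext (?_ : n + 16 * e ≡ 0 [MOD 4 * e] ↔ n ≡ 0 [MOD 4 * e])
    rw [Nat.modEq_zero_iff_dvd, Nat.modEq_zero_iff_dvd, Nat.dvd_add_left ⟨4, by ring⟩]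
  have hTle : ((Finset.Ico b (b + 16 * e)).filter (· ∈ dyadicSet T)).card ≤
      (16 * e).count common + 4 := by
    have h4 : (16 * e).count (fun n => n ≡ 0 [MOD 4 * e]) = 4 := by
      rw [Nat.count_modEq_card _ (by omega), show 16 * e = 4 * e * 4 by ring,
        Nat.mul_div_cancel_left _ (by omega)]
      simp
    refine le_of_le_of_eq ?_ (congrArg _ h4)
    rw [← Nat.filter_Ico_card_eq_of_periodic b _ _ hper,
      ← Nat.filter_Ico_card_eq_of_periodic b _ _ hper']
    refine (Finset.card_le_card fun n hn => ?_).trans (Finset.card_union_le _ _)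
    obtain ⟨hn, i, hi, hin⟩ := Finset.mem_filter.1 hn
    rw [Finset.mem_union, Finset.mem_filter, Finset.mem_filter]
    rcases lt_trichotomy i k with h | rfl | h
    · exact Or.inl ⟨hn, i, h, (hlt i h).2 hi, hin⟩
    · exact absurd hi hT
    · refine Or.inr ⟨hn, Nat.modEq_zero_iff_dvd.2 (dvd_trans ?_ (pow_dvd_of_mod_eq hin))⟩
      have : 4 * e = 4 ^ (k + 3) := by rw [he]; ring
      rw [this]
      exact pow_dvd_pow 4 (by omega)
  have hSge : (16 * e).count common + 8 ≤
      ((Finset.range (16 * e)).filter (· ∈ dyadicSet S)).card := by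
    have h8 : (16 * e).count (fun n => n ≡ e [MOD 2 * e]) = 8 := by
      rw [Nat.count_modEq_card _ (by omega), show 16 * e = 2 * e * 8 by ring,
        Nat.mul_div_cancel_left _ (by omega)]
      simp
    rw [← h8, Nat.count_eq_card_filter_range, Nat.count_eq_card_filter_range,
      ← Finset.card_union_of_disjoint]
    · refine Finset.card_le_card fun n hn => ?_
      rw [Finset.mem_union, Finset.mem_filter, Finset.mem_filter] at hn
      rcases hn with ⟨hn, i, -, hi, hin⟩ | ⟨hn, hin⟩
      · exact Finset.mem_filter.2 ⟨hn, i, hi, hin⟩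
      · exact Finset.mem_filter.2 ⟨hn, k, hS, Eq.trans hin (Nat.mod_eq_of_lt (by omega))⟩
    · refine Finset.disjoint_filter.2 fun n _ hc hin => ?_
      obtain ⟨i, hik, -, hi⟩ := hc
      exact not_dvd_of_mod_eq hi (two_mul_four_pow_dvd (show i + 2 < k + 2 by omega))
        (pow_dvd_of_mod_eq (Eq.trans hin (Nat.mod_eq_of_lt (by omega))))
  omega

/-- The surplus of 4 exceeds the possible loss of 3: two clique vertices outside `dyadicSet T` and
the stray vertex `a`. -/
theorem not_graphAge_dyadicSet_subset {S T : Set ℕ} {k : ℕ} (hlt : ∀ i < k, (i ∈ S ↔ i ∈ T))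
    (hS : k ∈ S) (hT : k ∉ T) :
    ¬graphAge (pinGraph (dyadicSet S)) ⊆ graphAge (pinGraph (dyadicSet T)) := by
  classical
  intro hsub
  obtain ⟨M, hM, hcard⟩ := card_dyadicSet_lt hlt hS hT
  obtain ⟨φ⟩ := hsub (a := ⟨M, initialPinGraph (dyadicSet S) M⟩)
    ⟨initialPinGraphEmbedding _ M⟩
  have hprime : IsPrimeGraph (initialPinGraph (dyadicSet S) M) :=
    isPrimeGraph_initialPinGraph (fun i h1 h4 h => by
      have := sixteen_dvd_of_mem_dyadicSet h
      omega) hM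
  obtain ⟨a, b, -, himg⟩ := hprime.image_eq_insert_Ico (by omega) φ
  set K₀ : Finset (Fin M) := Finset.univ.filter fun i => i.val ∈ dyadicSet S
  set K : Finset ℕ := K₀.image φ with hK
  have hKcard : K.card = ((Finset.range M).filter (· ∈ dyadicSet S)).card := by
    rw [hK, Finset.card_image_of_injective _ φ.injective]
    refine Finset.card_bij (fun i _ => i.val) ?_ (fun i _ j _ h => Fin.ext h) ?_
    · intro i hi
      exact Finset.mem_filter.2 ⟨Finset.mem_range.2 i.2, (Finset.mem_filter.1 hi).2⟩
    · intro n hn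
      obtain ⟨hn, hnS⟩ := Finset.mem_filter.1 hn
      exact ⟨⟨n, Finset.mem_range.1 hn⟩, Finset.mem_filter.2 ⟨Finset.mem_univ _, hnS⟩, rfl⟩
  have hclique : (pinGraph (dyadicSet T)).IsClique K := by
    intro x hx y hy hxy
    obtain ⟨i, hi, rfl⟩ := Finset.mem_image.1 hx
    obtain ⟨j, hj, rfl⟩ := Finset.mem_image.1 hy
    exact φ.map_adj_iff.2 (isClique_dyadicSet S (Finset.mem_filter.1 hi).2
      (Finset.mem_filter.1 hj).2 fun h => hxy (congrArg φ (Fin.ext h)))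
  have h1 := card_clique_sdiff_le hclique
  have h2 : (K.filter (· ∈ dyadicSet T)).card ≤
      ((Finset.Ico b (b + M)).filter (· ∈ dyadicSet T)).card + 1 := by
    refine (Finset.card_le_card fun n hn => ?_).trans (Finset.card_insert_le a _)
    obtain ⟨hn, hnT⟩ := Finset.mem_filter.1 hn
    have := Finset.image_subset_image (Finset.subset_univ K₀) hn
    rw [himg, Finset.mem_insert, Finset.mem_Ico] at this
    rw [Finset.mem_insert, Finset.mem_filter, Finset.mem_Ico]
    exact this.imp_right fun h => ⟨by omega, hnT⟩
  have h3 := Finset.card_filter_add_card_filter_not (s := K) (· ∈ dyadicSet T)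
  have h4 := hcard b
  omega

theorem graphAge_dyadicSet_injective :
    Function.Injective fun S => graphAge (pinGraph (dyadicSet S)) := by
  classical
  intro S T h
  by_contra hne
  have hex : ∃ k, ¬(k ∈ S ↔ k ∈ T) := by
    by_contra! hall
    exact hne (Set.ext hall)
  have hlt : ∀ i < Nat.find hex, (i ∈ S ↔ i ∈ T) := fun i hi => not_not.1 (Nat.find_min hex hi)
  by_cases hS : Nat.find hex ∈ S
  · exact not_graphAge_dyadicSet_subset hlt hS
      (fun hT => Nat.find_spec hex (iff_of_true hS hT)) h.subset
  · refine not_graphAge_dyadicSet_subset (fun i hi => (hlt i hi).symm)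
      (by_contra fun hT => Nat.find_spec hex (iff_of_false hS hT)) hS h.superset

/-! ### The cardinality -/

theorem mainTheorem8 :
    Cardinal.mk {C : Set FinGraph //
        (∃ (V : Type) (G : SimpleGraph V), IsPermutationGraph G ∧ C = graphAge G) ∧
          IsMinimalPrimeClass C} = 2 ^ Cardinal.aleph0 ∧
    Cardinal.mk {C : Set FinGraph //
        (∃ (V : Type) (G : SimpleGraph V), C = graphAge G) ∧
          (∀ H ∈ C, IsPermutationGraph H.2) ∧
          IsMinimalPrimeClass C} = 2 ^ Cardinal.aleph0 := by
  have upper : ∀ P : Set FinGraph → Prop, Cardinal.mk {C // P C} ≤ 2 ^ Cardinal.aleph0 := by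
    intro P
    refine (Cardinal.mk_subtype_le P).trans ?_
    rw [Cardinal.mk_set]
    exact Cardinal.power_le_power_left two_ne_zero Cardinal.mk_le_aleph0
  have hperm : ∀ S : Set ℕ, 0 ∈ S → IsPermutationGraph (pinGraph (dyadicSet S)) := fun S hS =>
    isPermutationGraph_pinGraph (dyadicSet_isolated_even hS)
  have lower : ∀ P : Set FinGraph → Prop,
      (∀ S : Set ℕ, 0 ∈ S → P (graphAge (pinGraph (dyadicSet S)))) →
      2 ^ Cardinal.aleph0 ≤ Cardinal.mk {C // P C} := by
    intro P hP
    rw [← Cardinal.mk_nat, ← Cardinal.mk_set]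
    refine Cardinal.mk_le_of_injective
      -- Shifting by one frees 0, whose presence provides the infinitely many sign changes needed
      -- for a permutation graph.
      (f := fun S : Set ℕ => ⟨_, hP (insert 0 (Nat.succ '' S)) (Set.mem_insert _ _)⟩)
      fun S T h => Nat.succ_injective.image_injective ?_
    have h' := graphAge_dyadicSet_injective (congrArg Subtype.val h)
    have h0 : ∀ S : Set ℕ, 0 ∉ Nat.succ '' S := by simp
    rw [← Set.insert_sdiff_self_of_notMem (h0 S), h', Set.insert_sdiff_self_of_notMem (h0 T)]
  refine ⟨(upper _).antisymm (lower _ fun S hS => ?_), (upper _).antisymm (lower _ fun S hS => ?_)⟩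
  · exact ⟨⟨ℕ, _, hperm S hS, rfl⟩, isMinimalPrimeClass_graphAge_dyadicSet S⟩
  · exact ⟨⟨ℕ, _, rfl⟩, fun H ⟨φ⟩ => (hperm S hS).of_embedding φ,
      isMinimalPrimeClass_graphAge_dyadicSet S⟩
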